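/- For $n\ge 0$ let $(q;q)_n=\prod_{j=1}^{n}(1-q^j)$ and $(q;q)_\infty=\prod_{j\ge 1}(1-q^j)$. Then $$\sum_{n\ge 0}\frac{q^{2n^2}}{(q;q)_{2n}}=\frac{1}{(q;q)_\infty}\sum_{k\in\mathbb Z}\left(q^{12k^2+k}-q^{12k^2+7k+1}\right),$$ both for every complex number $q$ with $|q|<1$ (where the infinite product and both series converge unconditionally and $(q;q)_\infty\neq 0$), and as an identity of formal power series in $\mathbb Z[[q]]$ (where the product and both series converge coefficientwise and $(q;q)_\infty$ has constant coefficient $1$). -/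

import Mathlib

/-- The finite `q`-Pochhammer symbol `(a; q)_n = ∏_{j=0}^{n-1} (1 - a q^j)`. -/
def qPochhammer {R : Type*} [CommRing R] (a q : R) (n : ℕ) : R :=
  ∏ j ∈ Finset.range n, (1 - a * q ^ j)

/-- The infinite `q`-Pochhammer symbol `(a; q)_∞ = ∏_{j ≥ 0} (1 - a q^j)`. -/
noncomputable def qPochhammerInf {R : Type*} [CommRing R] [TopologicalSpace R] (a q : R) : R :=
  ∏' j : ℕ, (1 - a * q ^ j)

-- Coefficientwise topology on power series; over the discrete ring `ℤ` a series converges iff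
-- each coefficient receives only finitely many nonzero contributions.
open scoped PowerSeries.WithPiTopology

open Filter Topology

/-! Write q = x². The left side consists of the even-indexed terms of Euler's series ∑ xⁿ² / (x²;
x²)_n, and since n² has the parity of n, these form its even part in x. Euler's product for the
series is ∏ (1 + x^(2j+1)); multiplied by (x²; x²)_∞ it becomes ∏ (1 - (-x)^(j+1)), which the
pentagonal number theorem expands. So the claim is the even part of the pentagonal series: the
pentagonal number of index j is even exactly for j = -4k (sign +, value 2(12k² + k)) and j = -4k - 1
(sign -, value 2(12k² + 7k + 1)). The even part is taken by adding the identities at x and -x and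
cancelling 2. `tsum_pow_sq_even_mul_tprod` does this in any suitable topological domain; what
remains for ℂ and ℤ⟦X⟧ is convergence and the passage between q and x. -/

/-! ### Parity of pentagonal numbers -/

theorem natCast_pentagonal_neg_four_mul (k : ℤ) :
    (pentagonal (-4 * k) : ℤ) = 2 * (12 * k ^ 2 + k) := by
  linarith [two_mul_natCast_pentagonal (-4 * k)]

theorem natCast_pentagonal_neg_four_mul_sub_one (k : ℤ) :
    (pentagonal (-4 * k - 1) : ℤ) = 2 * (12 * k ^ 2 + 7 * k + 1) := by
  linarith [two_mul_natCast_pentagonal (-4 * k - 1)]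

theorem even_pentagonal_neg_four_mul (k : ℤ) : Even (pentagonal (-4 * k)) := by
  have := natCast_pentagonal_neg_four_mul k
  grind

theorem even_pentagonal_neg_four_mul_sub_one (k : ℤ) : Even (pentagonal (-4 * k - 1)) := by
  have := natCast_pentagonal_neg_four_mul_sub_one k
  grind

theorem injective_neg_four_mul_elim :
    Function.Injective (Sum.elim (fun k : ℤ => -4 * k) fun k : ℤ => -4 * k - 1) := by
  rintro (a | a) (b | b) h <;> simp at h ⊢ <;> omega

/-- A pentagonal number with index outside `{-4k} ∪ {-4k - 1}` is odd. -/
theorem odd_pentagonal_of_notMem_range {j : ℤ}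
    (hj : j ∉ Set.range (Sum.elim (fun k : ℤ => -4 * k) fun k : ℤ => -4 * k - 1)) :
    Odd (pentagonal j) := by
  have h₁ : ∀ k : ℤ, j ≠ -4 * k := fun k hk => hj ⟨.inl k, by simp [hk]⟩
  have h₂ : ∀ k : ℤ, j ≠ -4 * k - 1 := fun k hk => hj ⟨.inr k, by simp [hk]⟩
  have h := two_mul_natCast_pentagonal j
  obtain ⟨i, hi | hi⟩ : ∃ i, j = 4 * i + 1 ∨ j = 4 * i + 2 := by
    refine ⟨j / 4, ?_⟩
    have := h₁ (-(j / 4))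
    have := h₂ (-(j / 4) - 1)
    omega
  · have : (pentagonal j : ℤ) = 2 * (12 * i ^ 2 + 5 * i) + 1 := by
      rw [hi] at h ⊢; linarith
    grind
  · have : (pentagonal j : ℤ) = 2 * (12 * i ^ 2 + 11 * i + 2) + 1 := by
      rw [hi] at h ⊢; linarith
    grind

/-! ### Euler's identity and even parts in a topological ring -/

section TopologicalRing

variable {R : Type*} [CommRing R] [TopologicalSpace R] [IsTopologicalRing R]

theorem hasSum_pow_sq_add_neg {x : R} {u : ℕ → R}
    (hs : Summable fun n : ℕ => x ^ (2 * n) ^ 2 * u (2 * n)) :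
    HasSum (fun n : ℕ => x ^ n ^ 2 * u n + (-x) ^ n ^ 2 * u n)
      (2 * ∑' n : ℕ, x ^ (2 * n) ^ 2 * u (2 * n)) := by
  rw [← Function.Injective.hasSum_iff (mul_right_injective₀ (two_ne_zero (α := ℕ)))]
  · refine (hs.hasSum.mul_left 2).congr_fun fun n => ?_
    have : Even ((2 * n) ^ 2) := (even_two_mul n).pow_of_ne_zero two_ne_zero
    simp only [Function.comp_apply, this.neg_pow]
    ring
  · intro n hn
    have : Odd n := by
      rw [← Nat.not_even_iff_odd, even_iff_exists_two_mul]
      rintro ⟨k, rfl⟩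
      exact hn ⟨k, rfl⟩
    rw [(this.pow (n := 2)).neg_pow]
    ring

variable [T2Space R]

/-- Euler's identity `∑ y^(n²) / (y²; y²)_n = ∏ (1 + y^(2j+1))` in a topological ring, given the
convergence of the sums that occur in its proof. The sequence `u` plays the role of
`1 / (y²; y²)_n`. -/
theorem tsum_pow_sq_mul_eq_tprod_one_add_pow {y : R} {u : ℕ → R} (hu₀ : u 0 = 1)
    (hu : ∀ n, u n = (1 - (y ^ 2) ^ (n + 1)) * u (n + 1))
    (hs : ∀ N : ℕ, Summable fun n : ℕ => y ^ (2 * N * n) * (y ^ n ^ 2 * u n))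
    (hlim : Tendsto (fun N : ℕ => ∑' n : ℕ, y ^ (2 * N * n) * (y ^ n ^ 2 * u n)) atTop (𝓝 1))
    (hm : Multipliable fun j : ℕ => 1 + y ^ (2 * j + 1)) :
    ∑' n : ℕ, y ^ n ^ 2 * u n = ∏' j : ℕ, (1 + y ^ (2 * j + 1)) := by
  set F : ℕ → R := fun N => ∑' n : ℕ, y ^ (2 * N * n) * (y ^ n ^ 2 * u n) with hF
  -- `F N` is Euler's series ∑ zⁿ yⁿ² u_n at z = y^(2N). In `F N - F (N + 1)` the factor 1 - y^(2n)
  -- turns u_n into u_(n-1), and shifting n leaves y^(2N+1) times `F (N + 1)`.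
  have step (N : ℕ) : F N = (1 + y ^ (2 * N + 1)) * F (N + 1) := by
    have h₁ := (summable_nat_add_iff 1).2 (hs (N + 1))
    have h₂ := (hs (N + 1)).mul_left (y ^ (2 * N + 1))
    have e₁ : F N = 1 + ∑' n : ℕ, y ^ (2 * N * (n + 1)) * (y ^ (n + 1) ^ 2 * u (n + 1)) := by
      simp [hF, (hs N).tsum_eq_zero_add, hu₀]
    have e₂ : F (N + 1) =
        1 + ∑' n : ℕ, y ^ (2 * (N + 1) * (n + 1)) * (y ^ (n + 1) ^ 2 * u (n + 1)) := by
      simp [hF, (hs (N + 1)).tsum_eq_zero_add, hu₀]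
    have e₃ : y ^ (2 * N + 1) * F (N + 1) =
        ∑' n : ℕ, y ^ (2 * N + 1) * (y ^ (2 * (N + 1) * n) * (y ^ n ^ 2 * u n)) :=
      (hs (N + 1)).tsum_mul_left _ |>.symm
    rw [add_mul, one_mul, e₃, e₁, e₂, add_assoc, ← h₁.tsum_add h₂]
    congr 1
    refine tsum_congr fun n => ?_
    rw [hu n]
    ring
  have iter (N : ℕ) : F 0 = (∏ j ∈ Finset.range N, (1 + y ^ (2 * j + 1))) * F N := by
    induction N with
    | zero => simp
    | succ N ih => rw [ih, step N, Finset.prod_range_succ, mul_assoc]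
  have h := hm.tendsto_prod_tprod_nat.mul hlim
  simp only [← iter, mul_one] at h
  rw [← tendsto_nhds_unique tendsto_const_nhds h]
  simp [hF]

/-- The sum of the pentagonal number series at `x` and `-x` is twice its even part. -/
theorem hasSum_pentagonal_add_neg {x : R}
    (hs₁ : Summable fun k : ℤ => x ^ pentagonal (-4 * k))
    (hs₂ : Summable fun k : ℤ => x ^ pentagonal (-4 * k - 1)) :
    HasSum (fun j : ℤ => (Int.negOnePow j : R) * x ^ pentagonal j +
        (Int.negOnePow j : R) * (-x) ^ pentagonal j)
      (2 * ∑' k : ℤ, (x ^ pentagonal (-4 * k) - x ^ pentagonal (-4 * k - 1))) := by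
  rw [← injective_neg_four_mul_elim.hasSum_iff, hs₁.tsum_sub hs₂, mul_sub, sub_eq_add_neg]
  · refine HasSum.sum ?_ ?_
    · refine (hs₁.hasSum.mul_left 2).congr_fun fun k => ?_
      have : Even (-4 * k) := by grind
      simp only [Function.comp_apply, Sum.elim_inl, Int.negOnePow_even _ this,
        (even_pentagonal_neg_four_mul k).neg_pow]
      push_cast
      ring
    · refine (hs₂.hasSum.mul_left 2).neg.congr_fun fun k => ?_
      have : Odd (-4 * k - 1) := by grind
      simp only [Function.comp_apply, Sum.elim_inr, Int.negOnePow_odd _ this,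
        (even_pentagonal_neg_four_mul_sub_one k).neg_pow]
      push_cast
      ring
  · intro j hj
    rw [(odd_pentagonal_of_notMem_range hj).neg_pow]
    ring

/-- Odd powers absorb the sign of y and even powers ignore it, so the two products are the odd and
even powers of -y in a single product. -/
theorem tprod_one_add_pow_odd_mul_tprod_one_sub_pow_even {y : R}
    (hm' : Multipliable fun j : ℕ => 1 + y ^ (2 * j + 1))
    (hm : Multipliable fun j : ℕ => 1 - (y ^ 2) ^ (j + 1)) :
    (∏' j : ℕ, (1 + y ^ (2 * j + 1))) * ∏' j : ℕ, (1 - (y ^ 2) ^ (j + 1)) =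
      ∏' j : ℕ, (1 - (-y) ^ (j + 1)) := by
  have e₁ (j : ℕ) : 1 + y ^ (2 * j + 1) = 1 - (-y) ^ (2 * j + 1) := by
    rw [(odd_two_mul_add_one j).neg_pow]; ring
  have e₂ (j : ℕ) : 1 - (y ^ 2) ^ (j + 1) = 1 - (-y) ^ (2 * j + 1 + 1) := by
    rw [← neg_sq y, ← pow_mul]; rfl
  simp only [e₁, e₂] at hm hm' ⊢
  exact tprod_even_mul_odd (f := fun j => 1 - (-y) ^ (j + 1)) hm' hm

/-- The sum of the even-indexed terms of Euler's series times `(x²; x²)_∞` is the even part of the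
pentagonal number series. -/
theorem tsum_pow_sq_even_mul_tprod [IsDomain R] (h2 : (2 : R) ≠ 0) {x : R} {u : ℕ → R}
    (hE : ∀ y : R, y = x ∨ y = -x →
      Summable (fun n : ℕ => y ^ n ^ 2 * u n) ∧ Multipliable (fun j : ℕ => 1 + y ^ (2 * j + 1)) ∧
      ∑' n : ℕ, y ^ n ^ 2 * u n = ∏' j : ℕ, (1 + y ^ (2 * j + 1)))
    (hP : ∀ y : R, y = x ∨ y = -x →
      HasSum (fun k : ℤ => (Int.negOnePow k : R) * y ^ pentagonal k) (∏' j : ℕ, (1 - y ^ (j + 1))))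
    (hm : Multipliable fun j : ℕ => 1 - (x ^ 2) ^ (j + 1))
    (hs : Summable fun n : ℕ => x ^ (2 * n) ^ 2 * u (2 * n))
    (hs₁ : Summable fun k : ℤ => x ^ pentagonal (-4 * k))
    (hs₂ : Summable fun k : ℤ => x ^ pentagonal (-4 * k - 1)) :
    (∏' j : ℕ, (1 - (x ^ 2) ^ (j + 1))) * ∑' n : ℕ, x ^ (2 * n) ^ 2 * u (2 * n) =
      ∑' k : ℤ, (x ^ pentagonal (-4 * k) - x ^ pentagonal (-4 * k - 1)) := by
  obtain ⟨s₁, m₁, e₁⟩ := hE x (.inl rfl)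
  obtain ⟨s₂, m₂, e₂⟩ := hE (-x) (.inr rfl)
  have p₁ := tprod_one_add_pow_odd_mul_tprod_one_sub_pow_even m₁ hm
  have p₂ := tprod_one_add_pow_odd_mul_tprod_one_sub_pow_even m₂ (by simpa using hm)
  rw [← e₁] at p₁
  rw [← e₂, neg_sq, neg_neg] at p₂
  have hL := (hasSum_pow_sq_add_neg hs).unique (s₁.hasSum.add s₂.hasSum)
  have hR := (hasSum_pentagonal_add_neg hs₁ hs₂).unique
    ((hP x (.inl rfl)).add (hP (-x) (.inr rfl)))
  -- Euler's series at x goes with the pentagonal series at -x and vice versa; the swap is harmless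
  -- in the sum.
  rw [← p₁, ← p₂] at hR
  refine mul_left_cancel₀ h2 ?_
  rw [hR]
  linear_combination (∏' j : ℕ, (1 - (x ^ 2) ^ (j + 1))) * hL

end TopologicalRing

/-! ### Complex q in the unit disc -/

namespace Complex

theorem one_sub_pow_succ_ne_zero {q : ℂ} (hq : ‖q‖ < 1) (j : ℕ) : 1 - q ^ (j + 1) ≠ 0 := by
  intro h
  have h1 : ‖q ^ (j + 1)‖ < 1 := by
    rw [norm_pow]
    exact pow_lt_one₀ (norm_nonneg _) hq j.succ_ne_zero
  rw [← sub_eq_zero.1 h, norm_one] at h1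
  exact lt_irrefl _ h1

theorem tprod_one_sub_pow_succ_ne_zero {q : ℂ} (hq : ‖q‖ < 1) :
    ∏' j : ℕ, (1 - q ^ (j + 1)) ≠ 0 := by
  simp only [sub_eq_add_neg]
  refine tprod_one_add_ne_zero_of_summable (fun j => ?_) ?_
  · rw [← sub_eq_add_neg]
    exact one_sub_pow_succ_ne_zero hq j
  · simp only [norm_neg, norm_pow]
    exact (summable_nat_add_iff 1).2 (summable_geometric_of_lt_one (norm_nonneg _) hq)

theorem exists_norm_prod_one_sub_pow_le {q : ℂ} (hq : ‖q‖ < 1) :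
    ∃ C, ∀ n : ℕ, ‖∏ j ∈ Finset.range n, (1 - q ^ (j + 1))‖ ≤ C := by
  have h := (ModularForm.multipliable_one_sub_pow hq).tendsto_prod_tprod_nat
  obtain ⟨C, hC⟩ := (Metric.isBounded_range_of_tendsto _ h).exists_norm_le
  exact ⟨C, fun n => hC _ ⟨n, rfl⟩⟩

theorem exists_norm_inv_prod_one_sub_pow_le {q : ℂ} (hq : ‖q‖ < 1) :
    ∃ C, ∀ n : ℕ, ‖(∏ j ∈ Finset.range n, (1 - q ^ (j + 1)))⁻¹‖ ≤ C := by
  have h := (ModularForm.multipliable_one_sub_pow hq).tendsto_prod_tprod_nat.inv₀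
    (tprod_one_sub_pow_succ_ne_zero hq)
  obtain ⟨C, hC⟩ := (Metric.isBounded_range_of_tendsto _ h).exists_norm_le
  exact ⟨C, fun n => hC _ ⟨n, rfl⟩⟩

/-- A shifted product is a quotient of two partial products, and these converge to a nonzero limit;
hence a bound uniform in the shift. -/
theorem exists_norm_prod_one_sub_pow_add_le {q : ℂ} (hq : ‖q‖ < 1) :
    ∃ C, ∀ k n : ℕ, ‖∏ i ∈ Finset.range n, (1 - q ^ (k + i + 1))‖ ≤ C := by
  obtain ⟨C, hC⟩ := exists_norm_prod_one_sub_pow_le hq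
  obtain ⟨D, hD⟩ := exists_norm_inv_prod_one_sub_pow_le hq
  refine ⟨D * C, fun k n => ?_⟩
  have h₀ : ∏ j ∈ Finset.range k, (1 - q ^ (j + 1)) ≠ 0 :=
    Finset.prod_ne_zero_iff.2 fun j _ => one_sub_pow_succ_ne_zero hq j
  have h : ∏ i ∈ Finset.range n, (1 - q ^ (k + i + 1)) =
      (∏ j ∈ Finset.range k, (1 - q ^ (j + 1)))⁻¹ *
        ∏ j ∈ Finset.range (k + n), (1 - q ^ (j + 1)) := by
    rw [Finset.prod_range_add, inv_mul_cancel_left₀ h₀]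
  rw [h, norm_mul]
  exact mul_le_mul (hD k) (hC _) (norm_nonneg _) ((norm_nonneg _).trans (hD 0))

theorem summable_pow_comp_of_injective {ι : Type*} {q : ℂ} (hq : ‖q‖ < 1) {e : ι → ℕ}
    (he : Function.Injective e) : Summable fun i => q ^ e i :=
  (summable_geometric_of_norm_lt_one hq).comp_injective he

theorem summable_norm_pow_comp_of_injective {ι : Type*} {q : ℂ} (hq : ‖q‖ < 1) {e : ι → ℕ}
    (he : Function.Injective e) : Summable fun i => ‖q‖ ^ e i :=
  (summable_geometric_of_lt_one (norm_nonneg _) hq).comp_injective he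

/-- **Pentagonal number theorem** for complex numbers in the open unit disc. -/
theorem hasSum_negOnePow_mul_pow_pentagonal {y : ℂ} (hy : ‖y‖ < 1) :
    HasSum (fun k : ℤ => (Int.negOnePow k : ℂ) * y ^ pentagonal k)
      (∏' j : ℕ, (1 - y ^ (j + 1))) := by
  have hs : Summable fun k : ℤ => (Int.negOnePow k : ℂ) * y ^ pentagonal k := by
    refine Summable.of_norm_bounded (summable_norm_pow_comp_of_injective hy pentagonal_injective)
      fun k => ?_
    rcases Int.even_or_odd k with h | h <;> simp [Int.negOnePow_even, Int.negOnePow_odd, h]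
  have hn : HasSum (fun k : ℕ => (-1) ^ k * (y ^ pentagonal (-k) - y ^ pentagonal (k + 1)))
      (∑' k : ℤ, (Int.negOnePow k : ℂ) * y ^ pentagonal k) := by
    have h := hs.hasSum
    -- Replace k by -k, then pair the indices k and -(k + 1).
    rw [← neg_injective.hasSum_iff (fun x hx => by absurd hx; use -x; simp)] at h
    convert h.nat_add_neg_add_one using 2 with k
    simp_rw [Function.comp_apply, neg_neg, Int.negOnePow_add]
    simp
    ring
  obtain ⟨C, hC⟩ := exists_norm_prod_one_sub_pow_add_le hy
  have hle (k n : ℕ) : ‖y ^ ((k + 1) * n) * ∏ i ∈ Finset.range (n + 1), (1 - y ^ (k + i + 1))‖ ≤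
      ‖y‖ ^ n * C := by
    rw [norm_mul, norm_pow]
    refine mul_le_mul (pow_le_pow_of_le_one (norm_nonneg _) hy.le ?_) (hC _ _) (norm_nonneg _)
      (by positivity)
    nlinarith
  have hgeom : Summable fun n : ℕ => ‖y‖ ^ n * C :=
    (summable_geometric_of_lt_one (norm_nonneg _) hy).mul_right C
  have hprod : ∏' j : ℕ, (1 - y ^ (j + 1)) =
      ∑' k : ℕ, (-1) ^ k * (y ^ pentagonal (-k) - y ^ pentagonal (k + 1)) := by
    refine Pentagonal.tprod_one_sub_pow (tendsto_pow_atTop_nhds_zero_of_norm_lt_one hy)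
      (fun k => Summable.of_norm_bounded hgeom (hle k)) (fun k => ?_) hn.summable ?_
    · have := multipliable_one_add_of_summable (f := fun n : ℕ => -y ^ (n + k + 1)) (by
        simp only [norm_neg, norm_pow]
        exact summable_norm_pow_comp_of_injective hy fun a b h => by simpa using h)
      simpa [sub_eq_add_neg] using this
    · refine squeeze_zero_norm (a := fun k : ℕ => ‖y‖ ^ k * ∑' n : ℕ, ‖y‖ ^ n * C)
        (fun k => ?_) ?_
      · rw [norm_mul, norm_mul, norm_pow, norm_neg, norm_one, one_pow, one_mul, norm_pow]
        refine mul_le_mul (pow_le_pow_of_le_one (norm_nonneg _) hy.le ?_)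
          (tsum_of_norm_bounded hgeom.hasSum (hle k)) (norm_nonneg _) (by positivity)
        rw [Nat.le_div_iff_mul_le two_pos]
        nlinarith
      · simpa using (tendsto_pow_atTop_nhds_zero_of_lt_one (norm_nonneg _) hy).mul_const
          (∑' n : ℕ, ‖y‖ ^ n * C)
  rw [hprod, hn.tsum_eq]
  exact hs.hasSum

theorem multipliable_one_add_pow_odd {y : ℂ} (hy : ‖y‖ < 1) :
    Multipliable fun j : ℕ => 1 + y ^ (2 * j + 1) := by
  refine multipliable_one_add_of_summable ?_
  simp only [norm_pow]
  exact summable_norm_pow_comp_of_injective hy fun a b h => by simpa using h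

/-- Euler's identity `∑ y^(n²) / (y²; y²)_n = ∏ (1 + y^(2j+1))` for `|y| < 1`. -/
theorem hasSum_pow_sq_mul_inv_prod {y : ℂ} (hy : ‖y‖ < 1) :
    HasSum (fun n : ℕ => y ^ n ^ 2 * (∏ j ∈ Finset.range n, (1 - (y ^ 2) ^ (j + 1)))⁻¹)
      (∏' j : ℕ, (1 + y ^ (2 * j + 1))) := by
  have hq : ‖y ^ 2‖ < 1 := by
    rw [norm_pow]; exact pow_lt_one₀ (norm_nonneg _) hy two_ne_zero
  set u : ℕ → ℂ := fun n => (∏ j ∈ Finset.range n, (1 - (y ^ 2) ^ (j + 1)))⁻¹ with hu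
  obtain ⟨C, hC⟩ := exists_norm_inv_prod_one_sub_pow_le hq
  have hC₀ : 0 ≤ C := (norm_nonneg _).trans (hC 0)
  have hb : Summable fun n : ℕ => ‖y‖ ^ n ^ 2 * C :=
    (summable_norm_pow_comp_of_injective hy (Nat.pow_left_injective two_ne_zero)).mul_right C
  have hle (N n : ℕ) : ‖y ^ (2 * N * n) * (y ^ n ^ 2 * u n)‖ ≤ ‖y‖ ^ n ^ 2 * C := by
    rw [norm_mul, norm_mul, norm_pow, norm_pow, ← one_mul (‖y‖ ^ n ^ 2 * C)]
    gcongr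
    · exact pow_le_one₀ (norm_nonneg _) hy.le
    · exact hC n
  have hs (N : ℕ) : Summable fun n : ℕ => y ^ (2 * N * n) * (y ^ n ^ 2 * u n) :=
    Summable.of_norm_bounded hb (hle N)
  have hs₀ : Summable fun n : ℕ => y ^ n ^ 2 * u n := by simpa using hs 0
  have hrec (n : ℕ) : u n = (1 - (y ^ 2) ^ (n + 1)) * u (n + 1) := by
    simp only [hu, Finset.prod_range_succ, mul_inv]
    rw [mul_left_comm, mul_inv_cancel₀ (one_sub_pow_succ_ne_zero hq n), mul_one]
  rw [← tsum_pow_sq_mul_eq_tprod_one_add_pow (u := u) (by simp [hu]) hrec hs ?_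
    (multipliable_one_add_pow_odd hy)]
  · exact hs₀.hasSum
  · have h := tendsto_tsum_of_dominated_convergence (𝓕 := atTop)
      (g := fun n : ℕ => if n = 0 then (1 : ℂ) else 0) hb (fun n => ?_)
      (Eventually.of_forall hle)
    · simpa using h
    · rcases n with _ | n
      · simp [hu]
      · have h₁ : Tendsto (fun N : ℕ => 2 * N * (n + 1)) atTop atTop :=
          tendsto_atTop_mono (fun N => show N ≤ 2 * N * (n + 1) by nlinarith [Nat.zero_le (N * n)]) tendsto_id
        simpa using ((tendsto_pow_atTop_nhds_zero_of_norm_lt_one hy).comp h₁).mul_const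
          (y ^ (n + 1) ^ 2 * u (n + 1))

theorem qPochhammer_self (q : ℂ) (n : ℕ) :
    qPochhammer q q n = ∏ j ∈ Finset.range n, (1 - q ^ (j + 1)) := by
  simp only [qPochhammer, pow_succ']

theorem qPochhammerInf_self (q : ℂ) : qPochhammerInf q q = ∏' j : ℕ, (1 - q ^ (j + 1)) := by
  simp only [qPochhammerInf, pow_succ']

theorem hasSum_pow_div_qPochhammer {q : ℂ} (hq : ‖q‖ < 1) :
    Summable (fun k : ℤ => q ^ (12 * k ^ 2 + k) - q ^ (12 * k ^ 2 + 7 * k + 1)) ∧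
    HasSum (fun n : ℕ => q ^ (2 * n ^ 2) / qPochhammer q q (2 * n))
      (1 / qPochhammerInf q q *
        ∑' k : ℤ, (q ^ (12 * k ^ 2 + k) - q ^ (12 * k ^ 2 + 7 * k + 1))) := by
  obtain ⟨x, rfl⟩ := IsAlgClosed.exists_pow_nat_eq q (n := 2) two_pos
  have hx : ‖x‖ < 1 := by
    rw [norm_pow] at hq
    exact (pow_lt_one_iff_of_nonneg (norm_nonneg _) two_ne_zero).1 hq
  have e₁ (k : ℤ) : (x ^ 2) ^ (12 * k ^ 2 + k) = x ^ pentagonal (-4 * k) := by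
    rw [← zpow_natCast x (pentagonal _), natCast_pentagonal_neg_four_mul, zpow_mul]; norm_cast
  have e₂ (k : ℤ) : (x ^ 2) ^ (12 * k ^ 2 + 7 * k + 1) = x ^ pentagonal (-4 * k - 1) := by
    rw [← zpow_natCast x (pentagonal _), natCast_pentagonal_neg_four_mul_sub_one, zpow_mul]
    norm_cast
  have hs₁ : Summable fun k : ℤ => x ^ pentagonal (-4 * k) :=
    summable_pow_comp_of_injective hx
      (pentagonal_injective.comp (injective_neg_four_mul_elim.comp Sum.inl_injective))
  have hs₂ : Summable fun k : ℤ => x ^ pentagonal (-4 * k - 1) :=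
    summable_pow_comp_of_injective hx
      (pentagonal_injective.comp (injective_neg_four_mul_elim.comp Sum.inr_injective))
  set u : ℕ → ℂ := fun n => (∏ j ∈ Finset.range n, (1 - (x ^ 2) ^ (j + 1)))⁻¹ with hu
  have hE (y : ℂ) (hy : y = x ∨ y = -x) : HasSum (fun n : ℕ => y ^ n ^ 2 * u n)
      (∏' j : ℕ, (1 + y ^ (2 * j + 1))) := by
    have hy₂ : y ^ 2 = x ^ 2 := sq_eq_sq_iff_eq_or_eq_neg.2 hy
    have hy₁ : ‖y‖ < 1 := by rcases hy with rfl | rfl <;> simpa using hx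
    simpa only [hu, hy₂] using hasSum_pow_sq_mul_inv_prod hy₁
  have hs : Summable fun n : ℕ => x ^ (2 * n) ^ 2 * u (2 * n) :=
    (hE x (.inl rfl)).summable.comp_injective (mul_right_injective₀ (two_ne_zero (α := ℕ)))
  have main := tsum_pow_sq_even_mul_tprod (x := x) (u := u) two_ne_zero
    (fun y hy => ⟨(hE y hy).summable, multipliable_one_add_pow_odd
      (by rcases hy with rfl | rfl <;> simpa using hx), (hE y hy).tsum_eq⟩)
    (fun y hy => hasSum_negOnePow_mul_pow_pentagonal
      (by rcases hy with rfl | rfl <;> simpa using hx))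
    (ModularForm.multipliable_one_sub_pow hq) hs hs₁ hs₂
  simp only [e₁, e₂]
  refine ⟨hs₁.sub hs₂, ?_⟩
  rw [← main, qPochhammerInf_self, one_div,
    inv_mul_cancel_left₀ (tprod_one_sub_pow_succ_ne_zero hq)]
  refine hs.hasSum.congr_fun fun n => ?_
  rw [qPochhammer_self, div_eq_mul_inv, ← pow_mul]
  congr 2
  ring

end Complex

/-! ### Formal power series -/

namespace PowerSeries

theorem qPochhammer_X (n : ℕ) :
    qPochhammer (X : ℤ⟦X⟧) X n = ∏ j ∈ Finset.range n, (1 - X ^ (j + 1)) := by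
  simp only [qPochhammer, pow_succ']

theorem qPochhammerInf_X : qPochhammerInf (X : ℤ⟦X⟧) X = pentagonalSeries ℤ := by
  simp only [qPochhammerInf, ← pow_succ', WithPiTopology.tprod_one_sub_X_pow]

theorem constantCoeff_prod_one_sub_X_pow (n : ℕ) :
    constantCoeff (∏ j ∈ Finset.range n, (1 - (X : ℤ⟦X⟧) ^ (j + 1))) = 1 := by
  simp [map_prod]

theorem constantCoeff_pentagonalSeries : constantCoeff (pentagonalSeries ℤ) = 1 := by
  have h := coeff_pentagonalSeries_pentagonal ℤ 0
  simpa [pentagonal] using h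

/-- A family whose `i`-th member is divisible by `X ^ e i`, for an injective `e`, is summable. -/
theorem summable_of_X_pow_dvd {ι : Type*} {f : ι → ℤ⟦X⟧} {e : ι → ℕ} (he : Function.Injective e)
    (hf : ∀ i, X ^ e i ∣ f i) : Summable f := by
  refine (WithPiTopology.summable_iff_summable_coeff ℤ).2 fun d =>
    summable_of_hasFiniteSupport (((Set.finite_Iic d).preimage he.injOn).subset fun i hi => ?_)
  by_contra h
  exact hi (X_pow_dvd_iff.1 (hf i) d (by simpa using h))

theorem multipliable_one_add_of_X_pow_dvd {f : ℕ → ℤ⟦X⟧} (hf : ∀ i, X ^ i ∣ f i) :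
    Multipliable fun i => 1 + f i := by
  refine WithPiTopology.multipliable_one_add_of_tendsto_order_atTop_nhds_top ℤ ?_
  refine tendsto_of_tendsto_of_tendsto_of_le_of_le ENat.tendsto_natCast_nhds_top
    tendsto_const_nhds (fun i => ?_) fun i => le_top
  exact le_order _ _ fun d hd => X_pow_dvd_iff.1 (hf i) d (by exact_mod_cast hd)

/-- Euler's identity `∑ y^(n²) / (y²; y²)_n = ∏ (1 + y^(2j+1))` for a power series `y` with
constant coefficient zero. -/
theorem tsum_pow_sq_mul_eq_tprod {y : ℤ⟦X⟧} (hy : X ∣ y) {u : ℕ → ℤ⟦X⟧} (hu₀ : u 0 = 1)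
    (hu : ∀ n, u n = (1 - (y ^ 2) ^ (n + 1)) * u (n + 1)) :
    Summable (fun n : ℕ => y ^ n ^ 2 * u n) ∧ Multipliable (fun j : ℕ => 1 + y ^ (2 * j + 1)) ∧
      ∑' n : ℕ, y ^ n ^ 2 * u n = ∏' j : ℕ, (1 + y ^ (2 * j + 1)) := by
  have hm : Multipliable fun j : ℕ => 1 + y ^ (2 * j + 1) :=
    multipliable_one_add_of_X_pow_dvd fun j =>
      (pow_dvd_pow X (by omega)).trans (pow_dvd_pow_of_dvd hy _)
  have hs (N : ℕ) : Summable fun n : ℕ => y ^ (2 * N * n) * (y ^ n ^ 2 * u n) :=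
    summable_of_X_pow_dvd (Nat.pow_left_injective two_ne_zero) fun n =>
      ((pow_dvd_pow_of_dvd hy _).mul_right _).mul_left _
  refine ⟨by simpa using hs 0, hm, tsum_pow_sq_mul_eq_tprod_one_add_pow hu₀ hu hs ?_ hm⟩
  rw [WithPiTopology.tendsto_iff_coeff_tendsto]
  -- For N > d every term with n ≥ 1 is divisible by X^(2Nn), of degree beyond d.
  refine fun d => tendsto_atTop_of_eventually_const fun N (hN : N ≥ d + 1) => ?_
  have h := (WithPiTopology.hasSum_iff_hasSum_coeff ℤ).1 (hs N).hasSum d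
  refine h.unique ?_
  have h₀ : coeff d (1 : ℤ⟦X⟧) = coeff d (y ^ (2 * N * 0) * (y ^ 0 ^ 2 * u 0)) := by simp [hu₀]
  rw [h₀]
  refine hasSum_single (f := fun n : ℕ => coeff d (y ^ (2 * N * n) * (y ^ n ^ 2 * u n))) 0 ?_
  · intro n hn
    have hdvd : (X : ℤ⟦X⟧) ^ (2 * N * n) ∣ y ^ (2 * N * n) * (y ^ n ^ 2 * u n) :=
      (pow_dvd_pow_of_dvd hy _).mul_right _
    refine X_pow_dvd_iff.1 hdvd d ?_
    have := Nat.pos_of_ne_zero hn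
    nlinarith

theorem continuous_rescale (a : ℤ) : Continuous (rescale a : ℤ⟦X⟧ →+* ℤ⟦X⟧) := by
  refine continuous_iff_continuousAt.2 fun f =>
    (WithPiTopology.tendsto_iff_coeff_tendsto ℤ _ _ _).2 fun d => ?_
  simp only [coeff_rescale]
  exact ((WithPiTopology.continuous_coeff ℤ d).tendsto f).const_mul _

theorem continuous_expand {p : ℕ} (hp : p ≠ 0) :
    Continuous (expand p hp : ℤ⟦X⟧ →ₐ[ℤ] ℤ⟦X⟧) := by
  refine continuous_iff_continuousAt.2 fun f =>
    (WithPiTopology.tendsto_iff_coeff_tendsto ℤ _ _ _).2 fun d => ?_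
  simp only [coeff_expand]
  split_ifs
  · exact (WithPiTopology.continuous_coeff ℤ _).tendsto f
  · exact tendsto_const_nhds

theorem expand_injective {p : ℕ} (hp : p ≠ 0) :
    Function.Injective (expand p hp : ℤ⟦X⟧ →ₐ[ℤ] ℤ⟦X⟧) := by
  intro f g h
  ext n
  rw [← coeff_expand_mul p hp f, h, coeff_expand_mul]

/-- **Pentagonal number theorem** for the power series `X` and `-X`. -/
theorem hasSum_negOnePow_mul_pow_pentagonal {y : ℤ⟦X⟧} (hy : y = X ∨ y = -X) :
    HasSum (fun k : ℤ => (Int.negOnePow k : ℤ⟦X⟧) * y ^ pentagonal k)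
      (∏' j : ℕ, (1 - y ^ (j + 1))) := by
  -- The case -X is the image of the case X under the continuous substitution X ↦ -X.
  obtain ⟨a, ha⟩ : ∃ a : ℤ, rescale a X = y := by
    rcases hy with rfl | rfl
    · exact ⟨1, by simp⟩
    · exact ⟨-1, by simp⟩
  have hs := (WithPiTopology.hasSum_pentagonalSeries ℤ).map (rescale a) (continuous_rescale a)
  have hp := (WithPiTopology.hasProd_one_sub_X_pow ℤ).map (rescale a) (continuous_rescale a)
  simp only [Function.comp_def, map_mul, map_sub, map_one, map_pow, ha, map_intCast] at hs hp
  rwa [hp.tprod_eq]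

theorem toNat_two_mul_eq_pentagonal (k : ℤ) : 2 * (12 * k ^ 2 + k).toNat = pentagonal (-4 * k) := by
  have := natCast_pentagonal_neg_four_mul k
  omega

theorem toNat_two_mul_eq_pentagonal_sub_one (k : ℤ) :
    2 * (12 * k ^ 2 + 7 * k + 1).toNat = pentagonal (-4 * k - 1) := by
  have := natCast_pentagonal_neg_four_mul_sub_one k
  omega

theorem hasSum_X_pow_mul_invOfUnit_qPochhammer :
    Summable (fun k : ℤ => (X : ℤ⟦X⟧) ^ (12 * k ^ 2 + k).toNat -
      X ^ (12 * k ^ 2 + 7 * k + 1).toNat) ∧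
    HasSum (fun n : ℕ => (X : ℤ⟦X⟧) ^ (2 * n ^ 2) * invOfUnit (qPochhammer X X (2 * n)) 1)
      (invOfUnit (pentagonalSeries ℤ) 1 *
        ∑' k : ℤ, ((X : ℤ⟦X⟧) ^ (12 * k ^ 2 + k).toNat - X ^ (12 * k ^ 2 + 7 * k + 1).toNat)) := by
  have i₁ : Function.Injective fun k : ℤ => pentagonal (-4 * k) :=
    pentagonal_injective.comp (injective_neg_four_mul_elim.comp Sum.inl_injective)
  have i₂ : Function.Injective fun k : ℤ => pentagonal (-4 * k - 1) :=
    pentagonal_injective.comp (injective_neg_four_mul_elim.comp Sum.inr_injective)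
  have hS : Summable fun k : ℤ => (X : ℤ⟦X⟧) ^ (12 * k ^ 2 + k).toNat -
      X ^ (12 * k ^ 2 + 7 * k + 1).toNat := by
    refine .sub (summable_of_X_pow_dvd (fun a b h => i₁ ?_) fun _ => dvd_rfl)
      (summable_of_X_pow_dvd (fun a b h => i₂ ?_) fun _ => dvd_rfl)
    · simp only [← toNat_two_mul_eq_pentagonal, h]
    · simp only [← toNat_two_mul_eq_pentagonal_sub_one, h]
  have hT : Summable fun n : ℕ =>
      (X : ℤ⟦X⟧) ^ (2 * n ^ 2) * invOfUnit (qPochhammer X X (2 * n)) 1 :=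
    summable_of_X_pow_dvd (e := fun n => 2 * n ^ 2) (fun a b h => by simpa using h)
      fun n => dvd_mul_right _ _
  refine ⟨hS, ?_⟩
  -- X has no square root here, so q = X is sent to X² instead; the identity is proved after this
  -- substitution and pulled back by injectivity.
  set φ : ℤ⟦X⟧ →ₐ[ℤ] ℤ⟦X⟧ := expand 2 two_ne_zero with hφ
  have hφc : Continuous φ := continuous_expand two_ne_zero
  have hφX : φ X = X ^ 2 := expand_X 2 two_ne_zero
  set u : ℕ → ℤ⟦X⟧ := fun n => φ (invOfUnit (qPochhammer X X n) 1) with hu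
  have hinv (n : ℕ) : (∏ j ∈ Finset.range n, (1 - (X ^ 2 : ℤ⟦X⟧) ^ (j + 1))) * u n = 1 := by
    have h := congrArg φ (mul_invOfUnit (qPochhammer (X : ℤ⟦X⟧) X n) 1
      (by rw [qPochhammer_X, constantCoeff_prod_one_sub_X_pow, Units.val_one]))
    rw [map_mul, map_one] at h
    refine Eq.trans ?_ h
    simp only [hu, hφX, qPochhammer_X, map_prod, map_sub, map_one, map_pow]
  have hu₁ (n : ℕ) : u n = (1 - (X ^ 2) ^ (n + 1)) * u (n + 1) := by
    have h := hinv (n + 1)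
    rw [Finset.prod_range_succ] at h
    -- Both sides are inverses of the same finite product, hence equal.
    linear_combination (1 - (X ^ 2) ^ (n + 1)) * u (n + 1) * hinv n - u n * h
  have hP := (WithPiTopology.hasProd_one_sub_X_pow ℤ).map φ hφc
  have hT' := hT.hasSum.map φ hφc
  have hS' := hS.hasSum.map φ hφc
  simp only [Function.comp_def, map_mul, map_sub, map_one, map_pow, hφX, ← pow_mul,
    toNat_two_mul_eq_pentagonal, toNat_two_mul_eq_pentagonal_sub_one] at hS' hP hT'
  have hT'' : HasSum (fun n : ℕ => (X : ℤ⟦X⟧) ^ (2 * n) ^ 2 * u (2 * n))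
      (φ (∑' n : ℕ, X ^ (2 * n ^ 2) * invOfUnit (qPochhammer X X (2 * n)) 1)) := by
    refine hT'.congr_fun fun n => ?_
    congr 2
    ring
  have h2 : (2 : ℤ⟦X⟧) ≠ 0 := fun h => by
    have h' := congrArg (constantCoeff (R := ℤ)) h
    rw [map_ofNat, map_zero] at h'
    exact two_ne_zero h'
  have main := tsum_pow_sq_even_mul_tprod (x := (X : ℤ⟦X⟧)) (u := u) h2
    (fun y hy => tsum_pow_sq_mul_eq_tprod (by rcases hy with rfl | rfl <;> simp)
      (by simpa using hinv 0) (by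
        have : y ^ 2 = X ^ 2 := sq_eq_sq_iff_eq_or_eq_neg.2 hy
        simpa only [this] using hu₁))
    (fun y hy => hasSum_negOnePow_mul_pow_pentagonal hy)
    (by simpa only [← pow_mul] using hP.multipliable) hT''.summable
    (summable_of_X_pow_dvd i₁ fun _ => dvd_rfl) (summable_of_X_pow_dvd i₂ fun _ => dvd_rfl)
  simp only [← pow_mul] at main
  have key : pentagonalSeries ℤ *
      ∑' n : ℕ, X ^ (2 * n ^ 2) * invOfUnit (qPochhammer X X (2 * n)) 1 =
      ∑' k : ℤ, ((X : ℤ⟦X⟧) ^ (12 * k ^ 2 + k).toNat - X ^ (12 * k ^ 2 + 7 * k + 1).toNat) := by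
    apply expand_injective two_ne_zero
    rw [← hφ, map_mul, ← hP.tprod_eq, ← hT''.tsum_eq, ← hS'.tsum_eq, main]
  rw [← key, ← mul_assoc, invOfUnit_mul _ _ constantCoeff_pentagonalSeries, one_mul]
  exact hT.hasSum

end PowerSeries

/-- The identity for complex `q` with `|q| < 1`, and as an identity of formal power series in the
indeterminate `q = X` over `ℤ`. All exponents `12k² + k` and `12k² + 7k + 1` are nonnegative, and
`PowerSeries.invOfUnit f 1` is the inverse of a series `f` with constant coefficient `1`. -/
theorem corollary5p5 :
    (∀ q : ℂ, ‖q‖ < 1 →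
      Multipliable (fun j : ℕ => 1 - q * q ^ j) ∧
      qPochhammerInf q q ≠ 0 ∧
      Summable (fun k : ℤ => q ^ (12 * k ^ 2 + k) - q ^ (12 * k ^ 2 + 7 * k + 1)) ∧
      HasSum (fun n : ℕ => q ^ (2 * n ^ 2) / qPochhammer q q (2 * n))
        (1 / qPochhammerInf q q *
          ∑' k : ℤ, (q ^ (12 * k ^ 2 + k) - q ^ (12 * k ^ 2 + 7 * k + 1)))) ∧
    (Multipliable (fun j : ℕ => 1 - (PowerSeries.X : PowerSeries ℤ) * PowerSeries.X ^ j) ∧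
      PowerSeries.constantCoeff
        (qPochhammerInf (PowerSeries.X : PowerSeries ℤ) PowerSeries.X) = 1 ∧
      Summable (fun k : ℤ => (PowerSeries.X : PowerSeries ℤ) ^ (12 * k ^ 2 + k).toNat -
        PowerSeries.X ^ (12 * k ^ 2 + 7 * k + 1).toNat) ∧
      HasSum (fun n : ℕ => (PowerSeries.X : PowerSeries ℤ) ^ (2 * n ^ 2) *
          PowerSeries.invOfUnit (qPochhammer PowerSeries.X PowerSeries.X (2 * n)) 1)
        (PowerSeries.invOfUnit (qPochhammerInf PowerSeries.X PowerSeries.X) 1 *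
          ∑' k : ℤ, ((PowerSeries.X : PowerSeries ℤ) ^ (12 * k ^ 2 + k).toNat -
            PowerSeries.X ^ (12 * k ^ 2 + 7 * k + 1).toNat))) := by
  refine ⟨fun q hq => ⟨?_, ?_, Complex.hasSum_pow_div_qPochhammer hq⟩, ?_, ?_, ?_⟩
  · simpa only [pow_succ'] using ModularForm.multipliable_one_sub_pow hq
  · rw [Complex.qPochhammerInf_self]
    exact Complex.tprod_one_sub_pow_succ_ne_zero hq
  · simpa only [pow_succ'] using (PowerSeries.WithPiTopology.hasProd_one_sub_X_pow ℤ).multipliable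
  · rw [PowerSeries.qPochhammerInf_X, PowerSeries.constantCoeff_pentagonalSeries]
  · rw [PowerSeries.qPochhammerInf_X]
    exact PowerSeries.hasSum_X_pow_mul_invOfUnit_qPochhammer
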